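/- Let $X$ be a finite set and let $X^*$ be the rooted tree of finite words over $X$, ordered by the prefix relation $\sqsubseteq$. $\mathrm{Aut}(X^*)$ is the group of bijections $g$ of $X^*$ with $u\sqsubseteq v\iff g(u)\sqsubseteq g(v)$. The section of $g$ at a word $u$ is the automorphism $g_u$ with $g(uw)=g(u)g_u(w)$ for all $w$; put $\psi_u(g)=g_u$. A leaf set is a finite $Y\subseteq X^*$ with $x\not\sqsubseteq y$ for all distinct $x,y\in Y$; it is spanning if there is $N$ such that every word of length at least $N$ has a prefix in $Y$. For $G\le \mathrm{Aut}(X^*)$ let $\mathrm{st}_G(Y)$ be the pointwise stabilizer of $Y$ in $G$ and $\mathrm{st}_G(n)=\mathrm{st}_G(X^n)$. For $K\le\mathrm{Aut}(X^*)$ and a leaf set $Y$, let $K^Y$ be the group of all $g\in\mathrm{Aut}(X^*)$ that fix each $y\in Y$ with $g_y\in K$ and fix every word that has no prefix in $Y$. Let $G\le\mathrm{Aut}(X^*)$ be a finitely generated group such that: (i) $G$ is regular branch: $g_x\in G$ for all $g\in G$, $x\in X^*$; $G$ acts transitively on every level $X^n$; and there is a normal subgroup $K$ of finite index in $G$ such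 that $K^{\{x\}}\le K$ for all $x\in X^*$ and $K^{X^n}$ has finite index in $G$ for all $n$; (ii) $G$ is just infinite: $G$ is infinite and every proper quotient of $G$ is finite; (iii) $G$ is strongly self-replicating: $\psi_x(\mathrm{st}_G(n))=G$ for all $n\ge 1$ and $x\in X^n$; (iv) $G$ has well-approximated subgroups: $\bigcap_{n\ge 0}H\,\mathrm{st}_G(n)=H$ for every finitely generated $H\le G$; (v) $G$ obeys the Grigorchuk--Nagnibeda alternative: for every finitely generated $H\le G$, either $\psi_y(H)=\{h_y : h\in H\}$ is finite for some $y\in X^*$, or there is a spanning leaf set $Y$ such that $\mathrm{st}_H(Y)$ is an infra-direct product of $G^Y$, that is, $\psi_y(\mathrm{st}_H(Y))$ is a finite index subgroup of $G$ for every $y\in Y$. Let $\mathrm{Sub}(G)$ be the space of subgroups of $G$ with the Chabauty topology, i.e. the subspace topology from $\{0,1\}^G$. Its perfect kernel is the set at which its transfinite sequence of Cantor--Bendixson derivatives stabilizes (equivalently, the intersection of all of these derivatives). If $L\le G$ does not belong to the perfect kernel of $\mathrm{Sub}(G)$, then the commensurator $$\mathrm{Comm}_G(L)=\{g\in G : |L:L\cap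 gLg^{-1}|<\infty \text{ and } |gLg^{-1}:L\cap gLg^{-1}|<\infty\}$$ contains $L$ as a subgroup of finite index, i.e. $|\mathrm{Comm}_G(L):L|<\infty$. -/

import Mathlib

open scoped Pointwise

/-- The automorphism group of the rooted tree `X^*`: the vertices are the words over `X` (lists),
and an automorphism is a bijection of the words such that `u` is a prefix of `v` if and only if
`g u` is a prefix of `g v`. Multiplication is composition, `(g * h) u = g (h u)`. -/
abbrev TreeAut (X : Type*) : Type _ :=
  (List.IsPrefix : List X → List X → Prop) ≃r (List.IsPrefix : List X → List X → Prop)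

namespace TreeAut

variable {X : Type*}

theorem apply_append_eq (g : TreeAut X) (u w : List X) :
    g (u ++ w) = g u ++ (g (u ++ w)).drop (g u).length := by
  obtain ⟨t, ht⟩ := g.map_rel_iff.2 (List.prefix_append u w)
  simp [← ht]

theorem symm_apply_append_eq (g : TreeAut X) (u w : List X) :
    g.symm (g u ++ w) = u ++ (g.symm (g u ++ w)).drop u.length := by
  simpa using apply_append_eq g.symm (g u) w

/-- The section `g_u` of `g` at the word `u`, characterized by `g (u w) = g(u) g_u(w)`
(see `apply_append`). -/
def sectionAt (u : List X) (g : TreeAut X) : TreeAut X where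
  toFun w := (g (u ++ w)).drop (g u).length
  invFun w := (g.symm (g u ++ w)).drop u.length
  left_inv w := by simp [← apply_append_eq]
  right_inv w := by simp [← symm_apply_append_eq]
  map_rel_iff' {a b} := by
    rw [Equiv.coe_fn_mk, ← List.prefix_append_right_inj (g u), ← apply_append_eq,
      ← apply_append_eq, g.map_rel_iff, List.prefix_append_right_inj]

theorem apply_append (g : TreeAut X) (u w : List X) :
    g (u ++ w) = g u ++ sectionAt u g w :=
  apply_append_eq g u w

theorem sectionAt_one (u : List X) : sectionAt u (1 : TreeAut X) = 1 := by
  ext1 w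
  refine List.append_cancel_left (as := u) ?_
  simpa using (apply_append (1 : TreeAut X) u w).symm

theorem sectionAt_mul (u : List X) (g h : TreeAut X) :
    sectionAt u (g * h) = sectionAt (h u) g * sectionAt u h := by
  ext1 w
  refine List.append_cancel_left (as := (g * h) u) ?_
  rw [← apply_append, RelIso.mul_apply, RelIso.mul_apply, RelIso.mul_apply, apply_append h,
    apply_append g]

theorem sectionAt_inv_of_fixed {u : List X} {g : TreeAut X} (hg : g u = u) :
    sectionAt u g⁻¹ = (sectionAt u g)⁻¹ := by
  refine eq_inv_of_mul_eq_one_left ?_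
  have h := sectionAt_mul u g⁻¹ g
  rwa [inv_mul_cancel, sectionAt_one, hg, eq_comm] at h

/-- The section map `ψ_u`, `g ↦ g_u`, on the stabilizer of the vertex `u`,
where it is a homomorphism. -/
def sectionHom (u : List X) : MulAction.stabilizer (TreeAut X) u →* TreeAut X where
  toFun g := sectionAt u g
  map_one' := sectionAt_one u
  map_mul' g h := by
    have hh : (h : TreeAut X) u = u := h.2
    simp [sectionAt_mul, hh]

/-- For a subgroup `H` that fixes the vertex `u`, the subgroup `ψ_u(H) = {h_u | h ∈ H}`. -/
def sectionSubgroup (u : List X) (H : Subgroup (TreeAut X)) : Subgroup (TreeAut X) :=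
  (H.subgroupOf (MulAction.stabilizer (TreeAut X) u)).map (sectionHom u)

/-- The level `X^n` of the tree: the words of length `n`. -/
def level (X : Type*) (n : ℕ) : Set (List X) := {u | u.length = n}

/-- `st_G(Y)`: the pointwise stabilizer in `G` of a set `Y` of vertices. -/
def stab (G : Subgroup (TreeAut X)) (Y : Set (List X)) : Subgroup (TreeAut X) :=
  G ⊓ fixingSubgroup (TreeAut X) Y

/-- `K^Y` for a leaf set `Y`: the automorphisms that fix the vertices of `Y`, act on the subtree
below each `y ∈ Y` as some element of `K`, and fix every vertex that is not in one of these
subtrees. -/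
def copies (K : Subgroup (TreeAut X)) (Y : Set (List X)) : Subgroup (TreeAut X) where
  carrier := {g | (∀ y ∈ Y, g y = y ∧ sectionAt y g ∈ K) ∧
    ∀ v : List X, (∀ y ∈ Y, ¬ y <+: v) → g v = v}
  one_mem' := ⟨fun y _ => ⟨rfl, by rw [sectionAt_one]; exact K.one_mem⟩, fun _ _ => rfl⟩
  mul_mem' := by
    rintro g h ⟨hg, hg'⟩ ⟨hh, hh'⟩
    refine ⟨fun y hy => ⟨?_, ?_⟩, fun v hv => ?_⟩
    · rw [RelIso.mul_apply, (hh y hy).1, (hg y hy).1]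
    · rw [sectionAt_mul, (hh y hy).1]
      exact K.mul_mem (hg y hy).2 (hh y hy).2
    · rw [RelIso.mul_apply, hh' v hv, hg' v hv]
  inv_mem' := by
    rintro g ⟨hg, hg'⟩
    refine ⟨fun y hy => ⟨?_, ?_⟩, fun v hv => ?_⟩
    · conv_lhs => rw [← (hg y hy).1]
      exact RelIso.inv_apply_self g y
    · rw [sectionAt_inv_of_fixed (hg y hy).1]
      exact K.inv_mem (hg y hy).2
    · conv_lhs => rw [← hg' v hv]
      exact RelIso.inv_apply_self g v

/-- A leaf set: a finite set of pairwise prefix-incomparable words. -/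
def IsLeafSet (Y : Set (List X)) : Prop :=
  Y.Finite ∧ ∀ x ∈ Y, ∀ y ∈ Y, x ≠ y → ¬ x <+: y

/-- A spanning leaf set: every sufficiently long word has a prefix in it. -/
def IsSpanningLeafSet (Y : Set (List X)) : Prop :=
  IsLeafSet Y ∧ ∃ N : ℕ, ∀ x : List X, N ≤ x.length → ∃ y ∈ Y, y <+: x

/-- A subgroup `H` that fixes `Y` pointwise is an infra-direct product of `G^Y`: for each `y ∈ Y`,
the projection `ψ_y(H)` to the coordinate `y` is a finite index subgroup of `G`. -/
def IsInfraDirectProduct (G : Subgroup (TreeAut X)) (Y : Set (List X))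
    (H : Subgroup (TreeAut X)) : Prop :=
  ∀ y ∈ Y, sectionSubgroup y H ≤ G ∧ (sectionSubgroup y H).relIndex G ≠ 0

/-- The Grigorchuk--Nagnibeda alternative. -/
def GrigorchukNagnibedaAlternative (G : Subgroup (TreeAut X)) : Prop :=
  ∀ H : Subgroup (TreeAut X), H ≤ G → H.FG →
    (∃ y : List X, (sectionAt y '' (H : Set (TreeAut X))).Finite) ∨
    ∃ Y : Set (List X), IsSpanningLeafSet Y ∧ IsInfraDirectProduct G Y (stab H Y)

/-- `G` is self-similar: it contains all sections of its elements. -/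
def IsSelfSimilar (G : Subgroup (TreeAut X)) : Prop :=
  ∀ g ∈ G, ∀ x : List X, sectionAt x g ∈ G

/-- `G` is strongly self-replicating: `ψ_x(st_G(n)) = G` for all `n ≥ 1` and `x ∈ X^n`. -/
def IsStronglySelfReplicating (G : Subgroup (TreeAut X)) : Prop :=
  ∀ n : ℕ, 1 ≤ n → ∀ x ∈ level X n, sectionSubgroup x (stab G (level X n)) = G

/-- `G` acts transitively on every level of the tree. -/
def IsLevelTransitive (G : Subgroup (TreeAut X)) : Prop :=
  ∀ n : ℕ, ∀ u ∈ level X n, ∀ v ∈ level X n, ∃ g ∈ G, g u = v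

/-- `G` is regular branch: self-similar, level transitive, with a normal finite index subgroup `K`
such that `K^{x} ≤ K` for every vertex `x` and `K^{X^n}` has finite index in `G` for all `n`. -/
def IsRegularBranch (G : Subgroup (TreeAut X)) : Prop :=
  IsSelfSimilar G ∧ IsLevelTransitive G ∧
    ∃ K : Subgroup (TreeAut X), K ≤ G ∧ (K.subgroupOf G).Normal ∧ K.relIndex G ≠ 0 ∧
      (∀ x : List X, copies K {x} ≤ K) ∧ ∀ n : ℕ, (copies K (level X n)).relIndex G ≠ 0

/-- `G` has well-approximated subgroups: `⋂ n, H st_G(n) = H` for every finitely generated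
`H ≤ G`. -/
def HasWellApproximatedSubgroups (G : Subgroup (TreeAut X)) : Prop :=
  ∀ H : Subgroup (TreeAut X), H ≤ G → H.FG →
    ⋂ n : ℕ, (H : Set (TreeAut X)) * (stab G (level X n) : Set (TreeAut X)) = H

end TreeAut

/-- A group is just infinite if it is infinite and every proper quotient is finite. -/
def IsJustInfinite (G : Type*) [Group G] : Prop :=
  Infinite G ∧ ∀ N : Subgroup G, N.Normal → N ≠ ⊥ → Finite (G ⧸ N)

/-- The Chabauty topology on the set `Sub(G)` of subgroups of a (discrete) group `G`: the subspace
topology from the power set of `G`, identified with `{0,1}^G` through indicator functions. -/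
noncomputable instance chabautyTopology (G : Type*) [Group G] : TopologicalSpace (Subgroup G) :=
  TopologicalSpace.induced (fun H : Subgroup G => ((H : Set G).boolIndicator : G → Bool))
    inferInstance

/-!
The proof has two parts.

First, let `P` be the set of the finitely generated subgroups of `G` that have only finitely many
sections at some vertex. It has no isolated points (`TreeAut.preperfect_finiteSectionSubgroups`):
adjoining to such a subgroup an element of a copy of the branching subgroup `K` at a deep vertex,
outside the orbit of another vertex of the same level, gives another one, and it is close to the
first because finitely generated subgroups are well approximated. So the closure of `P` lies in the
perfect kernel. If `L` is not in the perfect kernel, then it has a neighbourhood disjoint from `P`,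
and hence a finitely generated subgroup `H ≤ L` that is not in `P`. The Grigorchuk-Nagnibeda
alternative for `H` yields a spanning leaf set `Y` such that the stabilizer of `Y` in `H`, and so the
stabilizer `M` of `Y` in `L`, projects to a finite index subgroup of `G` at each vertex of `Y`.

Second, `M` has finite index in the stabilizer `C` of `Y` in the commensurator of `L`
(`relIndex_ne_zero_of_coordinates`). The sections embed `C` into `G^Y`, and the elements supported on
initial segments of `Y` give a filtration of `C`; it suffices to compare `M` and `C` on each of its
factors, which are subgroups of `G` normalized by a finite index subgroup. An element of such a
factor commutes, modulo the factor of `M`, with a finite index subgroup of `G`, since it commensurates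
`M`. This forces finite index (`relIndex_ne_zero_of_virtually_central`), for two reasons: in a just
infinite group, a normal subgroup of a normal finite index subgroup generates a finite index subgroup
together with its centralizer (`index_sup_centralizer_ne_zero`), and finite index
subgroups of `G` have trivial centralizers, because of the copies of `K`
(`TreeAut.centralizer_eq_bot`).
-/

/-! ### Subgroups of just infinite groups -/

section JustInfinite

variable {Γ : Type*} [Group Γ]

/-- In a just infinite group, a normal subgroup `N` of a normal finite index subgroup `H` generates
together with its centralizer a subgroup of finite index. Take a nontrivial intersection `B` of `H`
with as many conjugates of `N` as possible: every conjugate of `B` is contained in `N` or commutes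
with `N`, and the normal closure of `B` has finite index. -/
theorem index_sup_centralizer_ne_zero
    (hji : ∀ N : Subgroup Γ, N.Normal → N ≠ ⊥ → N.index ≠ 0)
    {H N : Subgroup Γ} [hHn : H.Normal] (hH : H ≠ ⊥) (hfi : H.index ≠ 0) (hNH : N ≤ H)
    (hN : ∀ h ∈ H, ∀ x ∈ N, h * x * h⁻¹ ∈ N) :
    (N ⊔ Subgroup.centralizer (N : Set Γ)).index ≠ 0 := by
  classical
  have : Finite (Γ ⧸ H) := Subgroup.index_ne_zero_iff_finite.1 hfi
  have : Fintype (Γ ⧸ H) := Fintype.ofFinite _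
  -- `c g` is the conjugate `g⁻¹ N g`; it depends only on the coset of `g` modulo `H`.
  let c : Γ → Subgroup Γ := fun g => N.comap (MulAut.conj g).toMonoidHom
  have hc : ∀ g x, x ∈ c g ↔ g * x * g⁻¹ ∈ N := fun g x => Iff.rfl
  have hcH : ∀ g, c g ≤ H := fun g x hx => by
    have h := hHn.conj_mem _ (hNH ((hc g x).1 hx)) g⁻¹
    simpa [mul_assoc] using h
  have hcn : ∀ g, ∀ h ∈ H, ∀ x ∈ c g, h * x * h⁻¹ ∈ c g := fun g h hh x hx => by
    rw [hc] at hx ⊢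
    have h' := hN _ (hHn.conj_mem h hh g) _ hx
    simpa [mul_assoc] using h'
  have hcc : ∀ g, ∀ h ∈ H, c (g * h) ≤ c g := fun g h hh x hx => by
    rw [hc]
    have h2 := hN _ (hHn.conj_mem _ (H.inv_mem hh) g) _ ((hc _ _).1 hx)
    simpa [mul_assoc] using h2
  have hout : ∀ g : Γ, c ((g : Γ ⧸ H).out) = c g := fun g => by
    obtain ⟨h, hh⟩ := QuotientGroup.mk_out_eq_mul H g
    rw [hh]
    refine le_antisymm (hcc g h h.2) ?_
    have := hcc (g * h) (h⁻¹ : H) (h⁻¹).2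
    simpa using this
  let B : Finset (Γ ⧸ H) → Subgroup Γ := fun S => H ⊓ ⨅ q ∈ S, c q.out
  have hB : ∀ S x, x ∈ B S ↔ x ∈ H ∧ ∀ q ∈ S, x ∈ c q.out := fun S x => by
    simp [B, Subgroup.mem_iInf]
  obtain ⟨S, hS⟩ : ∃ S, Maximal (fun S => B S ≠ ⊥) S := by
    refine (Set.toFinite {S | B S ≠ ⊥}).exists_maximal ⟨∅, ?_⟩
    simpa [B] using hH
  -- By maximality, each conjugate of `N` contains `B S` or meets it trivially.
  have hdich : ∀ g, B S ≤ c g ∨ ∀ x ∈ B S, x ∈ c g → x = 1 := by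
    intro g
    by_cases hg : (g : Γ ⧸ H) ∈ S
    · left
      intro x hx
      have := ((hB S x).1 hx).2 _ hg
      rwa [hout] at this
    · right
      intro x hx hxg
      by_contra hx1
      refine hg (hS.le_of_ge (y := insert (g : Γ ⧸ H) S) ?_ (Finset.subset_insert _ _)
        (Finset.mem_insert_self _ _))
      intro hbot
      refine hx1 (Subgroup.mem_bot.1 (hbot ▸ (hB _ x).2 ⟨((hB S x).1 hx).1, fun q hq => ?_⟩))
      rcases Finset.mem_insert.1 hq with rfl | hq
      · rwa [hout]
      · exact ((hB S x).1 hx).2 q hq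
  have hBn : ∀ h ∈ H, ∀ x ∈ B S, h * x * h⁻¹ ∈ B S := fun h hh x hx => by
    rw [hB] at hx ⊢
    exact ⟨hHn.conj_mem _ hx.1 h, fun q hq => hcn _ h hh x (hx.2 q hq)⟩
  have hle : Subgroup.normalClosure (B S : Set Γ) ≤ N ⊔ Subgroup.centralizer (N : Set Γ) := by
    refine (Subgroup.closure_le _).2 fun x hx => ?_
    obtain ⟨b, hb, hbx⟩ := Group.mem_conjugatesOfSet_iff.1 hx
    obtain ⟨g, rfl⟩ := isConj_iff.1 hbx
    rcases hdich g with h | h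
    · exact Subgroup.mem_sup_left (h hb)
    · refine Subgroup.mem_sup_right (Subgroup.mem_centralizer_iff.2 fun n hn => ?_)
      have hn' : g⁻¹ * n * g ∈ c g := by rw [hc]; simpa [mul_assoc] using hn
      have hbH := ((hB S b).1 hb).1
      -- `B S` and `c g` are both normal in `H`, so this commutator lies in both of them.
      have h1 : b * (g⁻¹ * n * g) * b⁻¹ * (g⁻¹ * n * g)⁻¹ = 1 := by
        apply h
        · have := hBn _ (hcH g hn') _ ((B S).inv_mem hb)
          simpa [mul_assoc] using (B S).mul_mem hb this
        · exact (c g).mul_mem (hcn g b hbH _ hn') ((c g).inv_mem hn')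
      have h2 : b * (g⁻¹ * n * g) = g⁻¹ * n * g * b := by
        rw [mul_inv_eq_one, mul_inv_eq_iff_eq_mul] at h1
        exact h1
      calc n * (g * b * g⁻¹) = g * (g⁻¹ * n * g * b) * g⁻¹ := by group
        _ = g * b * g⁻¹ * n := by rw [← h2]; group
  have hne : Subgroup.normalClosure (B S : Set Γ) ≠ ⊥ := fun h =>
    hS.prop (le_bot_iff.1 (h ▸ Subgroup.le_normalClosure))
  intro h0
  exact hji _ Subgroup.normalClosure_normal hne
    (Nat.eq_zero_of_zero_dvd (h0 ▸ Subgroup.index_dvd_of_le hle))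

theorem index_sup_ne_zero_of_le_centralizer {M C A : Subgroup Γ}
    (hC : C ≤ Subgroup.centralizer (M : Set Γ)) (h : (M ⊔ C).index ≠ 0)
    (hA : A.index ≠ 0) : (M ⊔ A ⊓ C).index ≠ 0 := by
  have hcomm : ∀ (m : M) (c : C), Commute (M.subtype m) (C.subtype c) := fun m c =>
    Subgroup.mem_centralizer_iff.1 (hC c.2) m m.2
  let f : M × C →* Γ := MonoidHom.noncommCoprod M.subtype C.subtype hcomm
  have hf : f.range = M ⊔ C := by
    simp [f, MonoidHom.noncommCoprod_range]
  have h1 : ((⊤ : Subgroup M).prod (A.subgroupOf C)).map f ≤ M ⊔ A ⊓ C := by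
    rintro _ ⟨⟨m, c⟩, hmc, rfl⟩
    have hc : (c : Γ) ∈ A := (Subgroup.mem_prod.1 hmc).2
    exact mul_mem (Subgroup.mem_sup_left m.2) (Subgroup.mem_sup_right ⟨hc, c.2⟩)
  intro h0
  have h2 := Nat.eq_zero_of_zero_dvd (h0 ▸ Subgroup.index_dvd_of_le h1)
  rw [Subgroup.index_map, hf] at h2
  rcases mul_eq_zero.1 h2 with h3 | h3
  · have h4 := Nat.eq_zero_of_zero_dvd (h3 ▸ Subgroup.index_dvd_of_le
      (le_sup_left : (⊤ : Subgroup M).prod (A.subgroupOf C) ≤ _ ⊔ f.ker))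
    rw [Subgroup.index_prod, Subgroup.index_top, one_mul] at h4
    exact hA (Subgroup.index_eq_zero_of_relIndex_eq_zero h4)
  · exact h h3

/-- If `M` is normalized by a finite index subgroup and each `γ ∈ C` commutes modulo `M` with a
finite index subgroup, then `M` has finite index in `C`. Let `M' = M ⊓ H` for the normal core `H` of
the given finite index subgroup. Then `M' ⊔ centralizer M'` has finite index. If it contains an
element `m * e` of `C`, with `m ∈ M'` and `e ∈ centralizer M'`, then `e` centralizes a finite index
subgroup, so `e = 1`. -/
theorem relIndex_ne_zero_of_virtually_central
    (hji : ∀ N : Subgroup Γ, N.Normal → N ≠ ⊥ → N.index ≠ 0) [Infinite Γ]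
    (hcent : ∀ D : Subgroup Γ, D.index ≠ 0 → Subgroup.centralizer (D : Set Γ) = ⊥)
    {M C Q : Subgroup Γ} (hMC : M ≤ C) (hQ : Q.index ≠ 0)
    (hMQ : ∀ q ∈ Q, ∀ m ∈ M, q * m * q⁻¹ ∈ M)
    (hC : ∀ γ ∈ C, ∃ D : Subgroup Γ, D.index ≠ 0 ∧ ∀ d ∈ D, d * γ * d⁻¹ * γ⁻¹ ∈ M) :
    M.relIndex C ≠ 0 := by
  have hQ' : Q.FiniteIndex := ⟨hQ⟩
  set H := Q.normalCore
  have hHQ : H ≤ Q := Q.normalCore_le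
  have hHi : H.index ≠ 0 := Subgroup.FiniteIndex.index_ne_zero
  have hHn : H.Normal := inferInstance
  have hH : H ≠ ⊥ := by
    intro h
    rw [h, Subgroup.index_bot] at hHi
    exact hHi Nat.card_eq_zero_of_infinite
  set M' := M ⊓ H
  have hM'H : ∀ h ∈ H, ∀ x ∈ M', h * x * h⁻¹ ∈ M' := fun h hh x hx =>
    ⟨hMQ h (hHQ hh) x hx.1, hHn.conj_mem _ hx.2 h⟩
  have hU := index_sup_centralizer_ne_zero hji hH hHi (inf_le_right : M' ≤ H) hM'H
  have key : C ⊓ (M' ⊔ Subgroup.centralizer (M' : Set Γ)) ≤ M := by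
    rintro γ ⟨hγC, hγU⟩
    obtain ⟨m, hm, e, he, rfl⟩ : ∃ m ∈ M', ∃ e ∈ Subgroup.centralizer (M' : Set Γ),
        m * e = γ := by
      have h := Subgroup.coe_mul_of_right_le_normalizer_left M' _
        (Subgroup.centralizer_le_normalizer (M' : Set Γ))
      have hγ : γ ∈ (M' : Set Γ) * (Subgroup.centralizer (M' : Set Γ) : Set Γ) := h ▸ hγU
      exact Set.mem_mul.1 hγ
    have heC : e ∈ C := by
      have := C.mul_mem (C.inv_mem (hMC hm.1)) hγC
      simpa using this
    obtain ⟨D, hD, hDe⟩ := hC e heC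
    have hi := index_sup_ne_zero_of_le_centralizer le_rfl hU (Subgroup.index_inf_ne_zero hD hHi)
    have he1 : e ∈ Subgroup.centralizer
        ((M' ⊔ (D ⊓ H) ⊓ Subgroup.centralizer (M' : Set Γ) : Subgroup Γ) : Set Γ) := by
      have h : M' ⊔ (D ⊓ H) ⊓ Subgroup.centralizer (M' : Set Γ) ≤ Subgroup.centralizer {e} := by
        refine sup_le (fun m hm => ?_) ?_
        · exact Subgroup.mem_centralizer_singleton_iff.2
            (Subgroup.mem_centralizer_iff.1 he m hm)
        · rintro d ⟨⟨hdD, hdH⟩, hdc⟩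
          have h1 : d * e * d⁻¹ * e⁻¹ ∈ M' := by
            refine ⟨hDe d hdD, ?_⟩
            have := H.mul_mem hdH (hHn.conj_mem _ (H.inv_mem hdH) e)
            simpa [mul_assoc] using this
          have h2 : d * e * d⁻¹ * e⁻¹ ∈ Subgroup.centralizer (M' : Set Γ) :=
            mul_mem (mul_mem (mul_mem hdc he) (inv_mem hdc)) (inv_mem he)
          -- An element of `M'` that centralizes `M'` centralizes `M' ⊔ centralizer M'`.
          have h3 : M' ⊔ Subgroup.centralizer (M' : Set Γ) ≤
              Subgroup.centralizer {d * e * d⁻¹ * e⁻¹} := by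
            refine sup_le (fun x hx => ?_) fun x hx => ?_
            · exact Subgroup.mem_centralizer_singleton_iff.2
                (Subgroup.mem_centralizer_iff.1 h2 x hx)
            · exact Subgroup.mem_centralizer_singleton_iff.2
                (Subgroup.mem_centralizer_iff.1 hx _ h1).symm
          have h4 : d * e * d⁻¹ * e⁻¹ ∈
              Subgroup.centralizer ((M' ⊔ Subgroup.centralizer (M' : Set Γ) : Subgroup Γ) : Set Γ) :=
            Subgroup.mem_centralizer_iff.2 fun x hx =>
              Subgroup.mem_centralizer_singleton_iff.1 (h3 hx)
          rw [hcent _ hU, Subgroup.mem_bot, mul_inv_eq_one, mul_inv_eq_iff_eq_mul] at h4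
          exact Subgroup.mem_centralizer_singleton_iff.2 h4
      exact Subgroup.mem_centralizer_iff.2 fun x hx =>
        Subgroup.mem_centralizer_singleton_iff.1 (h hx)
    rw [hcent _ hi, Subgroup.mem_bot] at he1
    subst he1
    simpa using hm.1
  intro h0
  have h1 := Subgroup.relIndex_eq_zero_of_le_left key h0
  rw [Subgroup.inf_relIndex_left] at h1
  exact hU (Subgroup.index_eq_zero_of_relIndex_eq_zero h1)

/-- Finite index of `P` in `N` can be checked on the image and on the kernel of a homomorphism. -/
theorem relIndex_ne_zero_of_map_of_inf_ker {S : Type*} [Group S] (f : S →* Γ) {P N : Subgroup S}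
    (hPN : P ≤ N)
    (h1 : (P.map f).relIndex (N.map f) ≠ 0) (h2 : P.relIndex (N ⊓ f.ker) ≠ 0) :
    P.relIndex N ≠ 0 := by
  set R : Subgroup S := (P.map f).comap f ⊓ N with hR
  have hRN : R.relIndex N ≠ 0 := by
    rwa [hR, Subgroup.inf_relIndex_right, Subgroup.relIndex_comap]
  refine Subgroup.relIndex_ne_zero_trans ?_ hRN
  have hle : N ⊓ f.ker ≤ R := fun x hx =>
    ⟨Subgroup.mem_comap.2 ((MonoidHom.mem_ker.1 hx.2).symm ▸ one_mem _), hx.1⟩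
  have : Finite ((N ⊓ f.ker : Subgroup S) ⧸ P.subgroupOf (N ⊓ f.ker)) :=
    Subgroup.index_ne_zero_iff_finite.1 h2
  have hs : Function.Surjective (Subgroup.quotientSubgroupOfEmbeddingOfLE P hle) := by
    rintro ⟨⟨r, ⟨p, hp, hpr⟩, hrN⟩⟩
    refine ⟨QuotientGroup.mk ⟨r * p⁻¹, N.mul_mem hrN (N.inv_mem (hPN hp)), ?_⟩, ?_⟩
    · simp [hpr]
    · rw [Subgroup.quotientSubgroupOfEmbeddingOfLE_apply_mk]
      refine QuotientGroup.eq.2 ?_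
      simpa [Subgroup.mem_subgroupOf] using hp
  exact Subgroup.index_ne_zero_iff_finite.2 (Finite.of_surjective _ hs)

/-- Let `π` embed `S` into a finite power of `Γ`, and let `M ≤ C ≤ S` be such that `C`
commensurates `M` and all coordinate projections of `M` have finite index. Then `M` has finite index
in `C`. The induction runs over the coordinates: at each step, the kernel of one coordinate `π a` in
a subgroup `N` normalized by `M` is handled by the induction hypothesis, and the image of `N` under
`π a` by `relIndex_ne_zero_of_virtually_central`. -/
theorem relIndex_ne_zero_of_coordinates
    (hji : ∀ N : Subgroup Γ, N.Normal → N ≠ ⊥ → N.index ≠ 0) [Infinite Γ]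
    (hcent : ∀ D : Subgroup Γ, D.index ≠ 0 → Subgroup.centralizer (D : Set Γ) = ⊥)
    {S ι : Type*} [Group S] [Finite ι] (π : ι → S →* Γ)
    (hπ : ∀ s, (∀ i, π i s = 1) → s = 1) {M C : Subgroup S} (hMC : M ≤ C)
    (hM : ∀ i, (M.map (π i)).index ≠ 0)
    (hC : ∀ c ∈ C, (M.map (MulAut.conj c).toMonoidHom).relIndex M ≠ 0) :
    M.relIndex C ≠ 0 := by
  classical
  have : Fintype ι := Fintype.ofFinite ι
  suffices h : ∀ (A : Finset ι) (N : Subgroup S), N ≤ C → (∀ m ∈ M, ∀ n ∈ N, m * n * m⁻¹ ∈ N) →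
      (∀ n ∈ N, (∀ i ∈ A, π i n = 1) → n = 1) → M.relIndex N ≠ 0 from
    h Finset.univ C le_rfl (fun m hm n hn => C.mul_mem (C.mul_mem (hMC hm) hn)
      (C.inv_mem (hMC hm))) fun n _ hn => hπ n fun i => hn i (Finset.mem_univ i)
  intro A
  induction A using Finset.induction_on with
  | empty =>
    intro N _ _ h
    have : N = ⊥ := (Subgroup.eq_bot_iff_forall N).2 fun n hn => h n hn (by simp)
    simp [this]
  | insert a A _ ih =>
    intro N hNC hN h
    have h2 : M.relIndex (N ⊓ (π a).ker) ≠ 0 := by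
      refine ih _ (inf_le_left.trans hNC) (fun m hm n hn => ⟨hN m hm n hn.1, ?_⟩)
        fun n hn hnA => h n hn.1 fun i hi => ?_
      · exact (π a).normal_ker.conj_mem n hn.2 m
      · rcases Finset.mem_insert.1 hi with rfl | hi
        · exact hn.2
        · exact hnA i hi
    rw [← Subgroup.inf_relIndex_right]
    refine relIndex_ne_zero_of_map_of_inf_ker (π a) inf_le_right ?_ ?_
    · refine relIndex_ne_zero_of_virtually_central hji hcent (Subgroup.map_mono inf_le_right)
        (hM a) ?_ ?_
      · rintro _ ⟨q, hq, rfl⟩ _ ⟨m, hm, rfl⟩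
        exact ⟨q * m * q⁻¹, ⟨M.mul_mem (M.mul_mem hq hm.1) (M.inv_mem hq), hN q hq m hm.2⟩,
          by simp⟩
      -- For `m ∈ M` with `n m n⁻¹ ∈ M`, the commutator of `m` and `n` lies in `M ⊓ N`.
      · rintro _ ⟨n, hn, rfl⟩
        refine ⟨(M ⊓ M.map (MulAut.conj n⁻¹).toMonoidHom).map (π a), ?_, ?_⟩
        · have h3 : (M ⊓ M.map (MulAut.conj n⁻¹).toMonoidHom).relIndex M ≠ 0 := by
            rw [Subgroup.inf_relIndex_left]
            exact hC n⁻¹ (C.inv_mem (hNC hn))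
          rw [← Subgroup.relIndex_mul_index (Subgroup.map_mono inf_le_left),
            ← Subgroup.relIndex_comap]
          exact mul_ne_zero (mt (Subgroup.relIndex_eq_zero_of_le_left
            (Subgroup.le_comap_map _ _)) h3) (hM a)
        · rintro _ ⟨m, ⟨hm, m', hm', hmm⟩, rfl⟩
          refine ⟨m * n * m⁻¹ * n⁻¹, ⟨?_, N.mul_mem (hN m hm n hn) (N.inv_mem hn)⟩, by simp⟩
          have h5 : m * n * m⁻¹ * n⁻¹ = m * m'⁻¹ := by
            have h6 : n⁻¹ * m' * n = m := by simpa using hmm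
            rw [← h6]
            group
          rw [h5]
          exact M.mul_mem hm (M.inv_mem hm')
    · refine Subgroup.relIndex_inf_ne_zero h2 ?_
      rw [Subgroup.relIndex_eq_one.2 inf_le_left]
      exact one_ne_zero

theorem Subgroup.le_commensurator (L : Subgroup Γ) :
    L ≤ Subgroup.Commensurable.commensurator L := fun l hl => by
  rw [Subgroup.Commensurable.commensurator_mem_iff,
    Subgroup.conjAct_pointwise_smul_eq_self (Subgroup.le_normalizer hl)]

end JustInfinite

/-! ### Automorphisms supported below a vertex -/

namespace TreeAut

variable {X : Type*}

theorem length_apply (g : TreeAut X) (u : List X) : (g u).length = u.length := by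
  have key : ∀ (h : TreeAut X) (w : List X), w.length ≤ (h w).length := fun h w => by
    induction w using List.reverseRecOn with
    | nil => simp
    | append_singleton w a ih =>
      have h1 : h w <+: h (w ++ [a]) := h.map_rel_iff.2 (List.prefix_append _ _)
      have h2 : (h w).length ≠ (h (w ++ [a])).length := fun h2 => by
        have := h.injective (h1.eq_of_length h2)
        simp at this
      have := h1.length_le
      simp only [List.length_append, List.length_singleton]
      omega
  refine le_antisymm ?_ (key g u)
  have := key g⁻¹ (g u)
  rwa [RelIso.inv_apply_self] at this

theorem apply_nil (g : TreeAut X) : g [] = [] :=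
  List.length_eq_zero_iff.1 (length_apply g [])

theorem apply_eq_of_prefix {g : TreeAut X} {u v : List X} (huv : u <+: v) (hv : g v = v) :
    g u = u := by
  have h : g u <+: v := hv ▸ g.map_rel_iff.2 huv
  exact (List.prefix_of_prefix_length_le h huv (length_apply g u).le).eq_of_length
    (length_apply g u)

theorem sectionAt_append (g : TreeAut X) (u v : List X) :
    sectionAt (u ++ v) g = sectionAt v (sectionAt u g) := by
  ext1 w
  refine List.append_cancel_left (as := g (u ++ v)) ?_
  rw [← apply_append, List.append_assoc, apply_append g u, apply_append (sectionAt u g) v,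
    apply_append g u v, List.append_assoc]

theorem sectionAt_eq_of_forall {g h : TreeAut X} {u : List X}
    (H : ∀ t, g (u ++ t) = h (u ++ t)) : sectionAt u g = sectionAt u h := by
  ext1 t
  have h0 : g u = h u := by simpa using H []
  refine List.append_cancel_left (as := g u) ?_
  rw [← apply_append, H, h0, ← apply_append]

open Classical in
/-- The automorphism that fixes the vertex `v`, acts as `k` on the subtree below `v`, and fixes
every vertex outside this subtree. -/
noncomputable def graft (v : List X) (k : TreeAut X) : TreeAut X where
  toFun w := if v <+: w then v ++ k (w.drop v.length) else w
  invFun w := if v <+: w then v ++ k.symm (w.drop v.length) else w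
  left_inv w := by
    by_cases h : v <+: w
    · obtain ⟨t, rfl⟩ := h
      simp
    · simp [h]
  right_inv w := by
    by_cases h : v <+: w
    · obtain ⟨t, rfl⟩ := h
      simp
    · simp [h]
  map_rel_iff' {a b} := by
    rw [Equiv.coe_fn_mk]
    by_cases ha : v <+: a <;> by_cases hb : v <+: b
    · obtain ⟨s, rfl⟩ := ha
      obtain ⟨t, rfl⟩ := hb
      simp [List.prefix_append_right_inj, k.map_rel_iff]
    · rw [if_pos ha, if_neg hb]
      exact iff_of_false (fun h => hb ((List.prefix_append _ _).trans h))
        fun h => hb (ha.trans h)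
    · rw [if_neg ha, if_pos hb]
      obtain ⟨t, rfl⟩ := hb
      -- A prefix of an extension of `v` that does not extend `v` is a prefix of `v`.
      have key : ∀ s, a <+: v ++ s ↔ a <+: v := fun s =>
        ⟨fun h => (List.prefix_or_prefix_of_prefix h (List.prefix_append v s)).resolve_right ha,
          fun h => h.trans (List.prefix_append v s)⟩
      rw [key, key]
    · rw [if_neg ha, if_neg hb]

theorem graft_apply_append (v : List X) (k : TreeAut X) (t : List X) :
    graft v k (v ++ t) = v ++ k t := by
  simp [graft]

theorem graft_apply_of_not_prefix {v w : List X} (k : TreeAut X) (h : ¬ v <+: w) :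
    graft v k w = w :=
  if_neg h

theorem graft_apply_self (v : List X) (k : TreeAut X) : graft v k v = v := by
  simpa [apply_nil] using graft_apply_append v k []

theorem sectionAt_graft (v : List X) (k : TreeAut X) : sectionAt v (graft v k) = k := by
  ext1 t
  refine List.append_cancel_left (as := graft v k v) ?_
  rw [← apply_append, graft_apply_append, graft_apply_self]

theorem graft_mem_copies {K : Subgroup (TreeAut X)} (v : List X) {k : TreeAut X} (hk : k ∈ K) :
    graft v k ∈ copies K {v} := by
  refine ⟨fun y hy => ?_, fun w hw => graft_apply_of_not_prefix k (hw v rfl)⟩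
  obtain rfl : y = v := hy
  exact ⟨graft_apply_self y k, (sectionAt_graft y k).symm ▸ hk⟩

theorem infinite_copies_singleton {K : Subgroup (TreeAut X)} [Infinite K] (v : List X) :
    Infinite (copies K {v}) :=
  Infinite.of_injective (fun k : K => (⟨graft v k, graft_mem_copies v k.2⟩ : copies K {v}))
    fun a b hab => Subtype.ext (by
      rw [← sectionAt_graft v (a : TreeAut X), ← sectionAt_graft v (b : TreeAut X)]
      exact congrArg (sectionAt v) (congrArg Subtype.val hab))

/-- If `G` contains copies of an infinite group below every vertex, then no nontrivial element
commutes with a finite index subgroup of `G`. -/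
theorem centralizer_eq_bot {G K : Subgroup (TreeAut X)} [Infinite K]
    (hKG : ∀ v, copies K {v} ≤ G) (D : Subgroup G) (hD : D.index ≠ 0) :
    Subgroup.centralizer (D : Set G) = ⊥ := by
  refine (Subgroup.eq_bot_iff_forall _).2 fun c hc => ?_
  by_contra hc1
  obtain ⟨v, hv⟩ : ∃ v, (c : TreeAut X) v ≠ v := by
    by_contra! h
    exact hc1 (Subtype.ext (RelIso.ext h))
  obtain ⟨h, hhD, hhP, hh1⟩ : ∃ h ∈ D, (h : TreeAut X) ∈ copies K {v} ∧ h ≠ 1 := by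
    by_contra! hall
    have hbot : D ⊓ (copies K {v}).subgroupOf G = ⊥ :=
      (Subgroup.eq_bot_iff_forall _).2 fun x hx => hall x hx.1 hx.2
    have : Infinite ((copies K {v}).subgroupOf G) := by
      have := infinite_copies_singleton (K := K) v
      exact (Subgroup.subgroupOfEquivOfLe (hKG v)).toEquiv.infinite_iff.2 this
    have h1 := Subgroup.inf_relIndex_right D ((copies K {v}).subgroupOf G)
    rw [hbot, Subgroup.relIndex_bot_left, Nat.card_eq_zero_of_infinite] at h1
    exact hD (Subgroup.index_eq_zero_of_relIndex_eq_zero h1.symm)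
  have hcomm : ∀ u, (h : TreeAut X) ((c : TreeAut X) u) = (c : TreeAut X) ((h : TreeAut X) u) :=
    fun u => by
      have := congrArg (fun x : G => (x : TreeAut X) u) (Subgroup.mem_centralizer_iff.1 hc h hhD)
      simpa using this
  refine hh1 (Subtype.ext (RelIso.ext fun w => ?_))
  by_cases hw : v <+: w
  · -- `c` moves the subtree below `v`, which supports `h`, off itself.
    have hcw : ¬ v <+: (c : TreeAut X) w := fun hcw => hv <|
      (List.prefix_of_prefix_length_le ((c : TreeAut X).map_rel_iff.2 hw) hcw
        (length_apply _ v).le).eq_of_length (length_apply _ v)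
    have h1 := hcomm w
    rw [hhP.2 _ (by simpa using hcw)] at h1
    exact ((c : TreeAut X).injective h1).symm
  · exact hhP.2 w (by simpa using hw)

end TreeAut

/-! ### Subgroups with finitely many sections at a vertex -/

/-- In the Chabauty topology, a neighbourhood of `L` contains all subgroups that agree with `L` on
some finite set. -/
theorem Subgroup.exists_agree_of_mem_nhds {Γ : Type*} [Group Γ] {L : Subgroup Γ}
    {U : Set (Subgroup Γ)} (hU : U ∈ nhds L) :
    ∃ F : Set Γ, F.Finite ∧ ∀ H : Subgroup Γ, (∀ f ∈ F, f ∈ H ↔ f ∈ L) → H ∈ U := by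
  rw [nhds_induced, Filter.mem_comap] at hU
  obtain ⟨V, hV, hVU⟩ := hU
  rw [nhds_pi, Filter.mem_pi] at hV
  obtain ⟨F, hF, t, ht, htV⟩ := hV
  refine ⟨F, hF, fun H hH => hVU (htV fun f hf => ?_)⟩
  have h1 : (H : Set Γ).boolIndicator f = (L : Set Γ).boolIndicator f := by
    rw [Bool.eq_iff_iff, ← Set.mem_iff_boolIndicator, ← Set.mem_iff_boolIndicator]
    exact hH f hf
  change (H : Set Γ).boolIndicator f ∈ t f
  exact h1.symm ▸ mem_of_mem_nhds (ht f)

namespace TreeAut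

variable {X : Type*}

/-- The set of the finitely generated subgroups of `G` with only finitely many sections at some
vertex. -/
def finiteSectionSubgroups (G : Subgroup (TreeAut X)) : Set (Subgroup G) :=
  {L | L.FG ∧ ∃ y, ((fun l : G => sectionAt y (l : TreeAut X)) '' (L : Set G)).Finite}

theorem nontrivial_of_infinite_subgroup {G : Subgroup (TreeAut X)} [Infinite G] :
    Nontrivial X := by
  by_contra h
  rw [not_nontrivial_iff_subsingleton] at h
  have hs : Subsingleton G := ⟨fun a b => Subtype.ext (RelIso.ext fun w =>
    List.ext_getElem ((length_apply _ w).trans (length_apply _ w).symm)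
      fun _ _ _ => Subsingleton.elim _ _)⟩
  exact not_finite G

/-- Finitely many automorphisms cannot move one vertex of a large enough level to all the others. -/
theorem exists_length_eq_notMem [Finite X] [Nontrivial X] {S : Set (TreeAut X)} (hS : S.Finite)
    (n : ℕ) : ∃ w w' : List X, n ≤ w.length ∧ w'.length = w.length ∧ ∀ s ∈ S, s w ≠ w' := by
  have : Fintype X := Fintype.ofFinite X
  obtain ⟨a⟩ : Nonempty X := inferInstance
  set m := n + S.ncard
  set w := List.replicate m a
  have hwl : w.length = m := List.length_replicate
  refine ⟨w, ?_⟩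
  have hlt : ((fun s : TreeAut X => s w) '' S).ncard < (level X m).ncard := by
    refine (Set.ncard_image_le hS).trans_lt ?_
    have h1 : (level X m).ncard = Fintype.card X ^ m := by
      rw [← card_vector, ← Nat.card_eq_fintype_card]
      rfl
    rw [h1]
    exact lt_of_le_of_lt (Nat.le_add_left _ n) (Nat.lt_pow_self Fintype.one_lt_card)
  obtain ⟨w', hw', hne⟩ := Set.exists_mem_notMem_of_ncard_lt_ncard hlt (hS.image _)
  refine ⟨w', by omega, hwl ▸ hw', fun s hs h => hne ⟨s, hs, h⟩⟩

theorem normal_subgroupOf_stab_level (G : Subgroup (TreeAut X)) (n : ℕ) :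
    ((stab G (level X n)).subgroupOf G).Normal := by
  refine ⟨fun h hh g => ⟨(g * h * g⁻¹).2, (mem_fixingSubgroup_iff _).2 fun u hu => ?_⟩⟩
  have h1 : (h : TreeAut X) ((g : TreeAut X)⁻¹ u) = (g : TreeAut X)⁻¹ u :=
    (mem_fixingSubgroup_iff _).1 hh.2 _ ((length_apply _ u).trans hu)
  change (g : TreeAut X) ((h : TreeAut X) ((g : TreeAut X)⁻¹ u)) = u
  rw [h1, RelIso.apply_inv_self]

theorem graft_mem_fixingSubgroup_level {v : List X} {n : ℕ} (h : n ≤ v.length) (k : TreeAut X) :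
    graft v k ∈ fixingSubgroup (TreeAut X) (level X n) := by
  refine (mem_fixingSubgroup_iff _).2 fun u hu => ?_
  change graft v k u = u
  by_cases hv : v <+: u
  · rw [← hv.eq_of_length (le_antisymm hv.length_le (le_of_eq_of_le hu h)), graft_apply_self]
  · exact graft_apply_of_not_prefix k hv

/-- Adjoining to `L` automorphisms that are trivial on the subtrees below the `L`-orbit of `z`
creates no new sections at `z`. -/
theorem exists_sectionAt_eq_of_mem_sup {L M : Subgroup (TreeAut X)} {z : List X}
    (hM : ∀ x ∈ M, ∀ l ∈ L, ∀ t, x (l (z ++ t)) = l (z ++ t)) {h : TreeAut X}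
    (hh : h ∈ L ⊔ M) : ∃ l ∈ L, sectionAt z h = sectionAt z l := by
  set O : Set (List X) := {u | ∃ l ∈ L, ∃ t, l (z ++ t) = u}
  have hLO : ∀ l ∈ L, ∀ u ∈ O, l u ∈ O := by
    rintro l hl _ ⟨l', hl', t, rfl⟩
    exact ⟨l * l', L.mul_mem hl hl', t, rfl⟩
  -- `L` preserves `O`, so each element of `L ⊔ M` is a product of an element of `L` and one that
  -- fixes `O` pointwise.
  have hnorm : L ≤ Subgroup.normalizer (fixingSubgroup (TreeAut X) O : Set (TreeAut X)) := by
    have hconj : ∀ l ∈ L, ∀ f ∈ fixingSubgroup (TreeAut X) O,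
        l * f * l⁻¹ ∈ fixingSubgroup (TreeAut X) O := fun l hl f hf => by
      refine (mem_fixingSubgroup_iff _).2 fun u hu => ?_
      have h1 : f (l⁻¹ u) = l⁻¹ u :=
        (mem_fixingSubgroup_iff _).1 hf _ (hLO _ (L.inv_mem hl) u hu)
      change l (f (l⁻¹ u)) = u
      rw [h1, RelIso.apply_inv_self]
    refine fun l hl => Subgroup.mem_normalizer_iff.2 fun f => ⟨hconj l hl f, fun hf => ?_⟩
    simpa [mul_assoc] using hconj _ (L.inv_mem hl) _ hf
  have hMO : M ≤ fixingSubgroup (TreeAut X) O := fun x hx =>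
    (mem_fixingSubgroup_iff _).2 (by
      rintro _ ⟨l, hl, t, rfl⟩
      exact hM x hx l hl t)
  have h1 : h ∈ (L : Set (TreeAut X)) * (fixingSubgroup (TreeAut X) O : Set (TreeAut X)) :=
    Subgroup.coe_mul_of_left_le_normalizer_right L _ hnorm ▸ sup_le_sup_left hMO L hh
  obtain ⟨l, hl, f, hf, rfl⟩ := Set.mem_mul.1 h1
  refine ⟨l, hl, sectionAt_eq_of_forall fun t => ?_⟩
  have h2 : f (z ++ t) = z ++ t :=
    (mem_fixingSubgroup_iff _).1 hf _ ⟨1, L.one_mem, t, rfl⟩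
  rw [RelIso.mul_apply, h2]

/-- A subgroup with finitely many sections at a vertex `y` is a limit of other such subgroups: adjoin
to it an element supported below a deep vertex `y ++ w'` outside the orbit of `y ++ w`. This changes
neither the sections at `y ++ w` nor the action on the levels above. -/
theorem preperfect_finiteSectionSubgroups [Finite X] {G K : Subgroup (TreeAut X)} [Infinite K]
    (hKG : ∀ v, copies K {v} ≤ G) (hwa : HasWellApproximatedSubgroups G) :
    Preperfect (finiteSectionSubgroups G) := by
  have hGinf : Infinite G := by
    have := infinite_copies_singleton (K := K) []
    exact Infinite.of_injective _ (Subgroup.inclusion_injective (hKG []))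
  have : Nontrivial X := nontrivial_of_infinite_subgroup (G := G)
  refine preperfect_iff_nhds.2 ?_
  rintro L ⟨hLfg, y, hy⟩ U hU
  obtain ⟨F, hF, hFU⟩ := Subgroup.exists_agree_of_mem_nhds hU
  -- A level whose stabilizer separates `L` from the elements of `F` outside `L`.
  have hsep : ∀ f : G, ∃ n, f ∉ L → f ∉ L ⊔ (stab G (level X n)).subgroupOf G := by
    intro f
    by_cases hf : f ∈ L
    · exact ⟨0, fun h => (h hf).elim⟩
    · have h1 := hwa (L.map G.subtype) (Subgroup.map_subtype_le L)
        ((Subgroup.fg_iff_submonoid_fg _).2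
        (((Subgroup.fg_iff_submonoid_fg _).1 hLfg).map G.subtype))
      have h2 : (f : TreeAut X) ∉ ((L.map G.subtype : Subgroup (TreeAut X)) : Set (TreeAut X)) :=
        fun ⟨l, hl, hlf⟩ => hf ((Subtype.ext hlf : l = f) ▸ hl)
      rw [← h1, Set.mem_iInter, not_forall] at h2
      obtain ⟨n, hn⟩ := h2
      refine ⟨n, fun _ hfn => hn ?_⟩
      have := normal_subgroupOf_stab_level G n
      rw [← SetLike.mem_coe, Subgroup.mul_normal] at hfn
      obtain ⟨l, hl, s, hs, rfl⟩ := Set.mem_mul.1 hfn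
      exact Set.mul_mem_mul ⟨l, hl, rfl⟩ hs
  choose N hN using hsep
  obtain ⟨n, hn⟩ : ∃ n, ∀ f ∈ F, N f ≤ n := by
    obtain ⟨n, hn⟩ := (hF.image N).bddAbove
    exact ⟨n, fun f hf => hn ⟨f, hf, rfl⟩⟩
  obtain ⟨w, w', hwn, hww, hS⟩ := exists_length_eq_notMem hy n
  -- The section at `y` of `graft (y ++ w') k` determines `k`, so `L` misses one of these.
  obtain ⟨k, hk, hkL⟩ : ∃ k : TreeAut X, ∃ hk : k ∈ K,
      (⟨graft (y ++ w') k, hKG _ (graft_mem_copies _ hk)⟩ : G) ∉ L := by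
    by_contra! hall
    have hinj : Function.Injective fun k : K =>
        sectionAt y (graft (y ++ w') (k : TreeAut X)) := fun k k' hkk => by
      have := congrArg (sectionAt w') hkk
      simp only [← sectionAt_append, sectionAt_graft] at this
      exact Subtype.ext this
    exact Set.infinite_of_injective_forall_mem
      (s := (fun l : G => sectionAt y (l : TreeAut X)) '' (L : Set G)) hinj
      (fun k => ⟨_, hall k k.2, rfl⟩) hy
  set g : G := ⟨graft (y ++ w') k, hKG _ (graft_mem_copies _ hk)⟩
  refine ⟨L ⊔ Subgroup.zpowers g, ⟨hFU _ fun f hf => ⟨fun hfL => ?_, fun hfL =>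
    Subgroup.mem_sup_left hfL⟩, hLfg.sup ?_, y ++ w, ?_⟩, fun h => hkL ?_⟩
  · by_contra hfn
    refine hN f hfn (sup_le_sup_left ?_ L hfL)
    rw [Subgroup.zpowers_le]
    refine ⟨g.2, graft_mem_fixingSubgroup_level ?_ k⟩
    have := hn f hf
    rw [List.length_append]
    omega
  · exact ⟨{g}, by rw [Finset.coe_singleton, Subgroup.zpowers_eq_closure]⟩
  · refine (hy.image (sectionAt w)).subset ?_
    rintro _ ⟨h, hh, rfl⟩
    have hh' : (h : TreeAut X) ∈ L.map G.subtype ⊔ Subgroup.zpowers (graft (y ++ w') k) := by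
      have := Subgroup.mem_map_of_mem G.subtype hh
      rwa [Subgroup.map_sup, MonoidHom.map_zpowers] at this
    have hM : ∀ x ∈ Subgroup.zpowers (graft (y ++ w') k), ∀ l ∈ L.map G.subtype, ∀ t,
        x (l (y ++ w ++ t)) = l (y ++ w ++ t) := by
      rintro x hx _ ⟨l, hl, rfl⟩ t
      set u := (l : TreeAut X) (y ++ w ++ t)
      suffices h : Subgroup.zpowers (graft (y ++ w') k) ≤ MulAction.stabilizer (TreeAut X) u from
        h hx
      rw [Subgroup.zpowers_le]
      -- A vertex below both `y ++ w'` and `l (y ++ w)` would make these equal, of equal length.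
      refine graft_apply_of_not_prefix k fun hpre => hS _ ⟨l, hl, rfl⟩ ?_
      have h1 : (l : TreeAut X) (y ++ w) <+: u :=
        (l : TreeAut X).map_rel_iff.2 (List.prefix_append _ _)
      have hlen : (y ++ w').length = ((l : TreeAut X) (y ++ w)).length := by
        rw [length_apply, List.length_append, List.length_append, hww]
      have h2 := (List.prefix_of_prefix_length_le hpre h1 hlen.le).eq_of_length hlen
      rw [apply_append] at h2
      exact ((List.append_inj h2 (length_apply _ y).symm).2).symm
    obtain ⟨_, ⟨l, hl, rfl⟩, hlh⟩ := exists_sectionAt_eq_of_mem_sup (z := y ++ w) hM hh'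
    refine ⟨sectionAt y (l : TreeAut X), ⟨l, hl, rfl⟩, ?_⟩
    rw [← sectionAt_append]
    exact hlh.symm
  · rw [← h]
    exact Subgroup.mem_sup_right (Subgroup.mem_zpowers g)

end TreeAut

/-! ### Commensurators of infra-direct products and the perfect kernel -/

namespace TreeAut

variable {X : Type*}

theorem index_stabilizer_word_ne_zero [Finite X] (G : Subgroup (TreeAut X)) (u : List X) :
    (MulAction.stabilizer G u).index ≠ 0 := by
  rw [MulAction.index_stabilizer]
  have hfin : (MulAction.orbit G u).Finite :=
    (List.finite_length_eq X u.length).subset (by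
      rintro _ ⟨g, rfl⟩
      exact length_apply (g : TreeAut X) u)
  exact ((Set.ncard_pos hfin).2 (MulAction.nonempty_orbit u)).ne'

theorem eq_one_of_sectionAt_eq_one [Nonempty X] {Y : Set (List X)} (hY : IsSpanningLeafSet Y)
    {g : TreeAut X} (hg : ∀ y ∈ Y, g y = y ∧ sectionAt y g = 1) : g = 1 := by
  obtain ⟨-, N, hN⟩ := hY
  obtain ⟨a⟩ := ‹Nonempty X›
  refine RelIso.ext fun w => apply_eq_of_prefix (List.prefix_append w (List.replicate N a)) ?_
  obtain ⟨y, hy, t, ht⟩ := hN (w ++ List.replicate N a) (by simp)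
  rw [← ht, apply_append, (hg y hy).1, (hg y hy).2]
  rfl

/-- If the pointwise stabilizer in `L` of a spanning leaf set `Y` projects to a finite index subgroup
of `G` at each `y ∈ Y`, then `L` has finite index in its commensurator: the stabilizer of `Y` in `G`
has finite index and embeds into the power `G^Y` by its sections. -/
theorem relIndex_commensurator_ne_zero [Finite X] [Nonempty X] {G : Subgroup (TreeAut X)}
    (hss : IsSelfSimilar G) (hji : IsJustInfinite G)
    (hcent : ∀ D : Subgroup G, D.index ≠ 0 → Subgroup.centralizer (D : Set G) = ⊥)
    {Y : Set (List X)} (hY : IsSpanningLeafSet Y) {L : Subgroup G}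
    (hL : ∀ y ∈ Y, (sectionSubgroup y (stab (L.map G.subtype) Y)).relIndex G ≠ 0) :
    L.relIndex (Subgroup.Commensurable.commensurator L) ≠ 0 := by
  have : Infinite G := hji.1
  have hYfin : Finite Y := hY.1.1
  set S : Subgroup G := ⨅ y : Y, MulAction.stabilizer G (y : List X) with hSdef
  have hSi : S.index ≠ 0 := Subgroup.index_iInf_ne_zero fun y =>
    index_stabilizer_word_ne_zero G (y : List X)
  have hSmem : ∀ g : G, g ∈ S ↔ ∀ y ∈ Y, (g : TreeAut X) y = y := fun g => by
    rw [hSdef, Subgroup.mem_iInf]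
    exact ⟨fun h y hy => h ⟨y, hy⟩, fun h y => h y y.2⟩
  let π : Y → S →* G := fun y =>
    { toFun := fun s => ⟨sectionAt (y : List X) ((s : G) : TreeAut X), hss _ (s : G).2 _⟩
      map_one' := Subtype.ext (sectionAt_one _)
      map_mul' := fun s t => Subtype.ext (by
        have ht := (hSmem t).1 t.2 y y.2
        simp [sectionAt_mul, ht]) }
  set C := Subgroup.Commensurable.commensurator L
  have key : (L.subgroupOf S).relIndex (C.subgroupOf S) ≠ 0 := by
    refine relIndex_ne_zero_of_coordinates
      (fun N hN hne => Subgroup.index_ne_zero_iff_finite.2 (hji.2 N hN hne)) hcent π ?_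
      (Subgroup.comap_mono (Subgroup.le_commensurator L)) ?_ ?_
    · intro s hs
      refine Subtype.ext (Subtype.ext (eq_one_of_sectionAt_eq_one hY fun y hy => ?_))
      exact ⟨(hSmem s).1 s.2 y hy, congrArg Subtype.val (hs ⟨y, hy⟩)⟩
    · intro y h0
      refine hL y y.2 (Nat.eq_zero_of_zero_dvd (h0 ▸ Subgroup.index_dvd_of_le ?_))
      rintro x ⟨⟨g, hg⟩, ⟨⟨l, hl, hlg⟩, hgY⟩, hx⟩
      have hlS : l ∈ S := (hSmem l).2 fun u hu => by
        change (G.subtype l) u = u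
        rw [hlg]
        exact (mem_fixingSubgroup_iff _).1 hgY u hu
      refine ⟨⟨l, hlS⟩, hl, Subtype.ext ?_⟩
      change sectionAt (y : List X) (G.subtype l) = x
      rw [hlg]
      exact hx
    · intro c hc
      have hc' : (ConjAct.toConjAct (c : G) • L).relIndex L ≠ 0 :=
        ((Subgroup.Commensurable.commensurator_mem_iff L _).1 hc).1
      have h1 : ((ConjAct.toConjAct (c : G) • L).subgroupOf S).relIndex (L.subgroupOf S) ≠ 0 := by
        rw [Subgroup.subgroupOf, Subgroup.relIndex_comap, Subgroup.subgroupOf_map_subtype]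
        exact mt (Subgroup.relIndex_eq_zero_of_le_right inf_le_left) hc'
      refine mt (Subgroup.relIndex_eq_zero_of_le_left ?_) h1
      intro s hs
      obtain ⟨l, hl, hls⟩ := (Subgroup.mem_smul_pointwise_iff_exists _ _ _).1 hs
      rw [ConjAct.toConjAct_smul] at hls
      have hls' : ((c⁻¹ * s * c : S) : G) = l := by
        change (c : G) * l * (c : G)⁻¹ = s at hls
        simp [← hls, mul_assoc]
      refine ⟨c⁻¹ * s * c, ?_, by simp [mul_assoc]⟩
      change ((c⁻¹ * s * c : S) : G) ∈ L
      rwa [hls']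
  rw [Subgroup.subgroupOf, Subgroup.relIndex_comap, Subgroup.subgroupOf_map_subtype] at key
  refine Subgroup.relIndex_ne_zero_trans key ?_
  rw [Subgroup.inf_relIndex_left]
  exact mt Subgroup.index_eq_zero_of_relIndex_eq_zero hSi

end TreeAut

theorem mainTheorem9 {X : Type*} [Finite X] (G : Subgroup (TreeAut X))
    (hfg : G.FG)
    (hbranch : TreeAut.IsRegularBranch G)
    (hji : IsJustInfinite G)
    (hssr : TreeAut.IsStronglySelfReplicating G)
    (hwa : TreeAut.HasWellApproximatedSubgroups G)
    (hGN : TreeAut.GrigorchukNagnibedaAlternative G)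
    (L : Subgroup G)
    (hL : L ∉ CantorBendixson.perfectKernel (Set.univ : Set (Subgroup G))) :
    L ≤ Subgroup.Commensurable.commensurator L ∧
      L.relIndex (Subgroup.Commensurable.commensurator L) ≠ 0 := by
  obtain ⟨hss, -, K, hKG, -, hKi, hK, -⟩ := hbranch
  have hGinf : Infinite G := hji.1
  have hX : Nontrivial X := TreeAut.nontrivial_of_infinite_subgroup (G := G)
  have hKinf : Infinite K := by
    by_contra hfin
    rw [not_infinite_iff_finite] at hfin
    have h1 := (K.subgroupOf G).card_mul_index
    rw [Nat.card_congr (Subgroup.subgroupOfEquivOfLe hKG).toEquiv,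
      Nat.card_eq_zero_of_infinite (α := G)] at h1
    exact (mul_ne_zero Nat.card_pos.ne' hKi) h1
  have hKc : ∀ v, TreeAut.copies K {v} ≤ G := fun v => (hK v).trans hKG
  -- The closure of a preperfect set is perfect, hence contained in the perfect kernel.
  have hLcl : L ∉ closure (TreeAut.finiteSectionSubgroups G) := fun h =>
    hL (((TreeAut.preperfect_finiteSectionSubgroups hKc hwa).perfect_closure).subset_perfectKernel
      (Set.subset_univ _) h)
  obtain ⟨F, hF, hFU⟩ := Subgroup.exists_agree_of_mem_nhds
    (isClosed_closure.isOpen_compl.mem_nhds hLcl)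
  -- The finitely generated subgroup `H` of `L` agrees with `L` on `F`, so it has infinitely many
  -- sections at every vertex, and the second case of the alternative holds for it.
  set H : Subgroup G := Subgroup.closure ((L : Set G) ∩ F)
  have hHL : H ≤ L := (Subgroup.closure_le _).2 Set.inter_subset_left
  have hHfg : H.FG := (Subgroup.fg_iff _).2 ⟨_, rfl, hF.subset Set.inter_subset_right⟩
  have hHn : H ∉ TreeAut.finiteSectionSubgroups G := fun h =>
    hFU H (fun f hf => ⟨fun hfH => hHL hfH, fun hfL => Subgroup.subset_closure ⟨hfL, hf⟩⟩)
      (subset_closure h)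
  refine ⟨Subgroup.le_commensurator L, ?_⟩
  rcases hGN (H.map G.subtype) (Subgroup.map_subtype_le H) ((Subgroup.fg_iff_submonoid_fg _).2
      (((Subgroup.fg_iff_submonoid_fg _).1 hHfg).map G.subtype)) with ⟨y, hy⟩ | ⟨Y, hY, hHY⟩
  · refine (hHn ⟨hHfg, y, ?_⟩).elim
    rwa [Subgroup.coe_map, Set.image_image] at hy
  · refine TreeAut.relIndex_commensurator_ne_zero hss hji (TreeAut.centralizer_eq_bot hKc) hY
      fun y hy => mt (Subgroup.relIndex_eq_zero_of_le_left ?_) (hHY y hy).2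
    exact Subgroup.map_mono (Subgroup.comap_mono (inf_le_inf_right _ (Subgroup.map_mono hHL)))
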